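/- Let $\mathcal H$ be a real or complex Hilbert space, let $A$ be a bounded selfadjoint operator on $\mathcal H$, and let $\mathcal F,\mathcal G\subseteq\mathcal H$ be nonzero closed subspaces with orthogonal projectors $P_{\mathcal F},P_{\mathcal G}$. Write $\Sigma(T)$ for the spectrum of a bounded operator $T$, $\mathrm{gap}(\mathcal F,\mathcal G)=\|P_{\mathcal F}-P_{\mathcal G}\|$, and, for nonempty bounded sets $S_1,S_2\subset\mathbb R$, \[ \mathrm{dist}(S_1,S_2)=\max\Big\{\sup_{u\in S_1}\inf_{v\in S_2}|u-v|,\ \sup_{v\in S_2}\inf_{u\in S_1}|u-v|\Big\} \] for their Hausdorff distance. Assume that $\mathcal F$ is $A$-invariant and corresponds to the top (or bottom) part of the spectrum of $A$, i.e. $\mu\le\lambda$ for all $\mu\in\Sigma(A|_{\mathcal F^\perp})$ and $\lambda\in\Sigma(A|_{\mathcal F})$ (respectively, $\lambda\le\mu$ for all such $\mu,\lambda$). Then \[ \mathrm{dist}\big(\Sigma(A|_{\mathcal F}),\,\Sigma((P_{\mathcal G}A)|_{\mathcal G})\big)\le\big(\max\Sigma(A)-\min\Sigma(A)\big)\,\mathrm{gap}^2(\mathcal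 F,\mathcal G). \] -/

import Mathlib

/-- The gap `‖P_F - P_G‖` between two closed subspaces of a Hilbert space. -/
noncomputable def gap {𝕜 H : Type*} [RCLike 𝕜] [NormedAddCommGroup H] [InnerProductSpace 𝕜 H]
    (F G : Submodule 𝕜 H) [F.HasOrthogonalProjection] [G.HasOrthogonalProjection] : ℝ :=
  ‖F.starProjection - G.starProjection‖

/-- The operator `(P_G A)|_G : G → G`; its spectrum is the set of Ritz values of `A` on the trial
subspace `G`. -/
noncomputable def ritzOperator {𝕜 H : Type*} [RCLike 𝕜] [NormedAddCommGroup H]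
    [InnerProductSpace 𝕜 H] (A : H →L[𝕜] H) (G : Submodule 𝕜 H) [G.HasOrthogonalProjection] :
    G →L[𝕜] G :=
  G.orthogonalProjectionOnto ∘L A ∘L G.subtypeL

/-- The orthogonal complement of an invariant subspace of a selfadjoint operator is invariant. -/
theorem orthogonal_invariant {𝕜 H : Type*} [RCLike 𝕜] [NormedAddCommGroup H]
    [InnerProductSpace 𝕜 H] [CompleteSpace H] {A : H →L[𝕜] H} (hA : IsSelfAdjoint A)
    {F : Submodule 𝕜 H} (hF : ∀ x ∈ F, A x ∈ F) : ∀ x ∈ Fᗮ, A x ∈ Fᗮ := by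
  intro x hx
  rw [Submodule.mem_orthogonal] at hx ⊢
  intro u hu
  have h : inner 𝕜 (A u) x = inner 𝕜 u (A x) := hA.isSymmetric u x
  rw [← h]
  exact hx _ (hF u hu)

/-- The invariant subspace `F` of the selfadjoint operator `A` corresponds to the top part of the
spectrum of `A`: no point of the spectrum of `A` on the orthogonal complement of `F` lies above a
point of the spectrum of `A` on `F`. (Both spectra consist of real numbers.) -/
def IsTopSpectralPart {𝕜 H : Type*} [RCLike 𝕜] [NormedAddCommGroup H]
    [InnerProductSpace 𝕜 H] [CompleteSpace H] {A : H →L[𝕜] H} (hA : IsSelfAdjoint A)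
    {F : Submodule 𝕜 H} (hF : ∀ x ∈ F, A x ∈ F) : Prop :=
  ∀ μ ∈ spectrum 𝕜 (A.restrict (orthogonal_invariant hA hF)),
    ∀ l ∈ spectrum 𝕜 (A.restrict hF), RCLike.re μ ≤ RCLike.re l

/-- The invariant subspace `F` of the selfadjoint operator `A` corresponds to the bottom part of the
spectrum of `A`: no point of the spectrum of `A` on the orthogonal complement of `F` lies below a
point of the spectrum of `A` on `F`. -/
def IsBottomSpectralPart {𝕜 H : Type*} [RCLike 𝕜] [NormedAddCommGroup H]
    [InnerProductSpace 𝕜 H] [CompleteSpace H] {A : H →L[𝕜] H} (hA : IsSelfAdjoint A)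
    {F : Submodule 𝕜 H} (hF : ∀ x ∈ F, A x ∈ F) : Prop :=
  ∀ μ ∈ spectrum 𝕜 (A.restrict (orthogonal_invariant hA hF)),
    ∀ l ∈ spectrum 𝕜 (A.restrict hF), RCLike.re l ≤ RCLike.re μ

/-! If the gap is at least one, it suffices that both spectra lie in `[m, M]`, where `m` and `M` are
the extremes of the spectrum of `A`. Otherwise let `α` be the minimum of the spectrum on `F`.
Replacing `A` by `A - α + ε` translates both spectra and makes `B = A|_F` positive definite.

With `T = P_G|_F`, invariance of `F` and `Fᗮ` gives `(P_G A)|_G = T B T* + P_G A P_{Fᗮ}|_G`. The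
last term has norm at most `(α - m + ε) gap²`, because `‖P_{Fᗮ} y‖ ≤ gap ‖y‖` on `G`. For the first,
write `B = K²`: the operator `T B T* = (TK)(TK)*` has the spectrum of `(TK)*(TK) = K T*T K`, which
differs from `B` by `K (1 - T*T) K`, of norm at most `(M - α + ε) gap²`. In each step the spectrum
moves by at most the norm of the perturbation. The constants add up to `M - m + 2ε`, and `ε → 0`.

The gap is squared because it enters only through quadratic forms: `hausdorffDist_spectrum_conj_le`
and `hausdorffDist_spectrum_ritzOperator_le_of_pos` carry the two halves. -/

/-! ### Quadratic form and spectrum of a selfadjoint operator -/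

theorem ContinuousLinearMap.inner_algebraMap_apply_self {𝕜 E : Type*} [RCLike 𝕜]
    [NormedAddCommGroup E] [InnerProductSpace 𝕜 E] (z : 𝕜) (x : E) :
    inner 𝕜 (algebraMap 𝕜 (E →L[𝕜] E) z x) x = star z * ((‖x‖ ^ 2 : ℝ) : 𝕜) := by
  rw [algebraMap_apply, inner_smul_left, inner_self_eq_norm_sq_to_K, RCLike.ofReal_pow]
  rfl

open RCLike in
theorem ContinuousLinearMap.norm_le_of_abs_re_inner_le {𝕜 E : Type*} [RCLike 𝕜]
    [NormedAddCommGroup E] [InnerProductSpace 𝕜 E] {T : E →L[𝕜] E}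
    (hT : T.IsSymmetric) {c : ℝ} (hc : 0 ≤ c) (h : ∀ x, |re (inner 𝕜 (T x) x)| ≤ c * ‖x‖ ^ 2) :
    ‖T‖ ≤ c := by
  rw [T.norm_eq_iSup_rayleighQuotient hT]
  refine ciSup_le fun x => ?_
  rw [rayleighQuotient, abs_div, abs_sq, reApplyInnerSelf_apply]
  exact div_le_of_le_mul₀ (by positivity) hc (h x)

/-- A selfadjoint operator on a nontrivial space has `‖T‖` or `-‖T‖` in its spectrum. -/
theorem IsSelfAdjoint.norm_mem_spectrum_or_neg {𝕜 E : Type*} [RCLike 𝕜] [NormedAddCommGroup E]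
    [InnerProductSpace 𝕜 E] [CompleteSpace E] [Nontrivial E] {T : E →L[𝕜] E}
    (hT : IsSelfAdjoint T) :
    algebraMap ℝ 𝕜 ‖T‖ ∈ spectrum 𝕜 T ∨ -algebraMap ℝ 𝕜 ‖T‖ ∈ spectrum 𝕜 T := by
  simp_rw [spectrum, Set.mem_compl_iff]
  by_contra! h
  obtain ⟨c, hc0, hc⟩ := T.abs_rayleighQuotient_le_of_norm_mem_resolventSet h.1 h.2
  grind [ciSup_le hc, T.norm_eq_iSup_rayleighQuotient hT.isSymmetric]

open RCLike in
/-- The supremum of the quadratic form of a selfadjoint operator belongs to the spectrum. -/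
theorem IsSelfAdjoint.exists_mem_spectrum_forall_re_inner_le {𝕜 E : Type*} [RCLike 𝕜]
    [NormedAddCommGroup E] [InnerProductSpace 𝕜 E] [CompleteSpace E] [Nontrivial E]
    {T : E →L[𝕜] E} (hT : IsSelfAdjoint T) :
    ∃ M : ℝ, (M : 𝕜) ∈ spectrum 𝕜 T ∧ ∀ x, re (inner 𝕜 (T x) x) ≤ M * ‖x‖ ^ 2 := by
  -- The shift by `‖T‖` makes the form nonnegative, so `‖S‖` itself is its supremum. Were `‖S‖` in
  -- the resolvent set, the Rayleigh quotient would stay a fixed `ε` below it.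
  set S : E →L[𝕜] E := algebraMap 𝕜 (E →L[𝕜] E) (‖T‖ : 𝕜) + T with hS
  have hform : ∀ x, re (inner 𝕜 (S x) x) = ‖T‖ * ‖x‖ ^ 2 + re (inner 𝕜 (T x) x) := by
    intro x
    rw [hS, add_apply, inner_add_left, ContinuousLinearMap.inner_algebraMap_apply_self, map_add,
      mul_comm, re_ofReal_mul]
    simp [mul_comm]
  have hSsa : IsSelfAdjoint S := by
    refine IsSelfAdjoint.add ?_ hT
    rw [Algebra.algebraMap_eq_smul_one]
    exact IsSelfAdjoint.smul (by simp [isSelfAdjoint_iff]) (IsSelfAdjoint.one _)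
  have habs : ∀ x, |re (inner 𝕜 (S x) x)| = re (inner 𝕜 (S x) x) := by
    intro x
    refine abs_of_nonneg ?_
    have h1 : |re (inner 𝕜 (T x) x)| ≤ ‖T‖ * ‖x‖ ^ 2 := by
      refine (abs_re_le_norm _).trans ((norm_inner_le_norm _ _).trans ?_)
      rw [sq, ← mul_assoc]
      exact mul_le_mul_of_nonneg_right (T.le_opNorm x) (norm_nonneg _)
    rw [hform]
    linarith [(abs_le.1 h1).1]
  refine ⟨‖S‖ - ‖T‖, ?_, fun x => ?_⟩
  · have hmem : algebraMap ℝ 𝕜 ‖S‖ ∈ spectrum 𝕜 S := by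
      by_contra hnot
      obtain ⟨ε, hε, h⟩ := S.rayleighQuotient_le_of_norm_mem_resolventSet
        (by simpa [spectrum] using hnot)
      have h2 : ∀ x, |S.rayleighQuotient x| ≤ ‖S‖ - ε := by
        intro x
        refine le_trans (le_of_eq ?_) (h x)
        rw [ContinuousLinearMap.rayleighQuotient, abs_div, abs_sq,
          ContinuousLinearMap.reApplyInnerSelf_apply, habs]
      have := S.norm_eq_iSup_rayleighQuotient hSsa.isSymmetric
      have := ciSup_le h2
      linarith
    have h3 : (((‖S‖ - ‖T‖ : ℝ) : 𝕜) + (‖T‖ : 𝕜)) ∈ spectrum 𝕜 S := by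
      simpa using hmem
    rw [hS] at h3
    exact spectrum.add_mem_add_iff.1 h3
  · have h1 : |re (inner 𝕜 (S x) x)| ≤ ‖S‖ * ‖x‖ ^ 2 := by
      refine (abs_re_le_norm _).trans ((norm_inner_le_norm _ _).trans ?_)
      rw [sq, ← mul_assoc]
      exact mul_le_mul_of_nonneg_right (S.le_opNorm x) (norm_nonneg _)
    have := (abs_le.1 h1).2
    rw [hform] at this
    linarith

open RCLike in
theorem IsSelfAdjoint.exists_mem_spectrum_forall_le_re_inner {𝕜 E : Type*} [RCLike 𝕜]
    [NormedAddCommGroup E] [InnerProductSpace 𝕜 E] [CompleteSpace E] [Nontrivial E]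
    {T : E →L[𝕜] E} (hT : IsSelfAdjoint T) :
    ∃ m : ℝ, (m : 𝕜) ∈ spectrum 𝕜 T ∧ ∀ x, m * ‖x‖ ^ 2 ≤ re (inner 𝕜 (T x) x) := by
  obtain ⟨M, hM, h⟩ := hT.neg.exists_mem_spectrum_forall_re_inner_le
  refine ⟨-M, ?_, fun x => ?_⟩
  · rw [← spectrum.neg_eq, Set.mem_neg] at hM
    simpa using hM
  · have := h x
    simp only [neg_apply, inner_neg_left, map_neg] at this
    linarith

theorem IsSelfAdjoint.nonempty_spectrum {𝕜 E : Type*} [RCLike 𝕜]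
    [NormedAddCommGroup E] [InnerProductSpace 𝕜 E] [CompleteSpace E] [Nontrivial E]
    {T : E →L[𝕜] E} (hT : IsSelfAdjoint T) : (spectrum 𝕜 T).Nonempty :=
  let ⟨M, hM, _⟩ := hT.exists_mem_spectrum_forall_re_inner_le
  ⟨M, hM⟩

theorem ContinuousLinearMap.isUnit_of_forall_mul_norm_sq_le {𝕜 E : Type*} [RCLike 𝕜]
    [NormedAddCommGroup E] [InnerProductSpace 𝕜 E] [CompleteSpace E] {T : E →L[𝕜] E} {c : ℝ}
    (hc : 0 < c) (h : ∀ x, c * ‖x‖ ^ 2 ≤ ‖inner 𝕜 (T x) x‖) : IsUnit T :=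
  isUnit_of_forall_le_norm_inner_map T (c := ⟨c, hc.le⟩) hc fun x => by
    rw [mul_comm]
    exact h x

open RCLike in
theorem IsSelfAdjoint.ofReal_re_eq_of_mem_spectrum {𝕜 E : Type*} [RCLike 𝕜]
    [NormedAddCommGroup E] [InnerProductSpace 𝕜 E] [CompleteSpace E]
    {T : E →L[𝕜] E} (hT : IsSelfAdjoint T) {z : 𝕜} (hz : z ∈ spectrum 𝕜 T) :
    ((re z : ℝ) : 𝕜) = z := by
  rw [← conj_eq_iff_re, conj_eq_iff_im]
  by_contra him
  -- The form of `T` is real, so `|im z|` is a coercivity constant for `z - T`.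
  refine hz (ContinuousLinearMap.isUnit_of_forall_mul_norm_sq_le (abs_pos.2 him) fun x => ?_)
  have h1 : im (inner 𝕜 (T x) x) = 0 := by
    rw [← conj_eq_iff_im, inner_conj_symm]
    exact (hT.isSymmetric x x).symm
  have h2 : im (inner 𝕜 ((algebraMap 𝕜 (E →L[𝕜] E) z - T) x) x) = -(im z * ‖x‖ ^ 2) := by
    rw [sub_apply, inner_sub_left, ContinuousLinearMap.inner_algebraMap_apply_self, map_sub, h1,
      mul_comm, im_ofReal_mul]
    simp [mul_comm]
  calc |im z| * ‖x‖ ^ 2 = |im (inner 𝕜 ((algebraMap 𝕜 (E →L[𝕜] E) z - T) x) x)| := by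
        rw [h2, abs_neg, abs_mul, abs_sq]
    _ ≤ _ := abs_im_le_norm _

open RCLike in
theorem ContinuousLinearMap.re_le_of_mem_spectrum {𝕜 E : Type*} [RCLike 𝕜]
    [NormedAddCommGroup E] [InnerProductSpace 𝕜 E] [CompleteSpace E]
    {T : E →L[𝕜] E} {M : ℝ} (h : ∀ x, re (inner 𝕜 (T x) x) ≤ M * ‖x‖ ^ 2)
    {z : 𝕜} (hz : z ∈ spectrum 𝕜 T) : re z ≤ M := by
  by_contra! hlt
  refine hz (isUnit_of_forall_mul_norm_sq_le (sub_pos.2 hlt) fun x => ?_)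
  have h2 : re (inner 𝕜 ((algebraMap 𝕜 (E →L[𝕜] E) z - T) x) x)
      = re z * ‖x‖ ^ 2 - re (inner 𝕜 (T x) x) := by
    rw [sub_apply, inner_sub_left, ContinuousLinearMap.inner_algebraMap_apply_self, map_sub,
      mul_comm, re_ofReal_mul]
    simp [mul_comm]
  refine le_trans ?_ (re_le_norm _)
  rw [h2]
  linarith [h x]

open RCLike in
theorem ContinuousLinearMap.le_re_of_mem_spectrum {𝕜 E : Type*} [RCLike 𝕜]
    [NormedAddCommGroup E] [InnerProductSpace 𝕜 E] [CompleteSpace E]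
    {T : E →L[𝕜] E} {m : ℝ} (h : ∀ x, m * ‖x‖ ^ 2 ≤ re (inner 𝕜 (T x) x))
    {z : 𝕜} (hz : z ∈ spectrum 𝕜 T) : m ≤ re z := by
  have : re (-z) ≤ -m := by
    refine re_le_of_mem_spectrum (T := -T) (fun x => ?_) ?_
    · simp only [neg_apply, inner_neg_left, map_neg]
      linarith [h x]
    · rw [← spectrum.neg_eq]
      simpa using hz
  rw [map_neg] at this
  linarith

/-! ### Additive perturbation of the spectrum -/

open RCLike in
/-- Every point of the spectrum of a selfadjoint `S` is within `‖S - T‖` of the spectrum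
of a selfadjoint `T`. -/
theorem IsSelfAdjoint.exists_mem_spectrum_norm_sub_le {𝕜 E : Type*} [RCLike 𝕜]
    [NormedAddCommGroup E] [InnerProductSpace 𝕜 E] [CompleteSpace E] [Nontrivial E]
    {S T : E →L[𝕜] E} (hS : IsSelfAdjoint S) (hT : IsSelfAdjoint T) {z : 𝕜}
    (hz : z ∈ spectrum 𝕜 S) : ∃ w ∈ spectrum 𝕜 T, ‖z - w‖ ≤ ‖S - T‖ := by
  by_contra! hfar
  have hzT : z ∉ spectrum 𝕜 T := fun h => by
    have := hfar z h
    simp only [sub_self, norm_zero] at this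
    exact absurd this (not_lt.2 (norm_nonneg _))
  obtain ⟨u, hu⟩ : IsUnit (algebraMap 𝕜 (E →L[𝕜] E) z - T) := by
    simpa [spectrum.mem_iff] using hzT
  have husa : IsSelfAdjoint u := by
    rw [isSelfAdjoint_iff, Units.ext_iff, Units.coe_star, hu]
    refine IsSelfAdjoint.sub ?_ hT
    rw [Algebra.algebraMap_eq_smul_one]
    refine IsSelfAdjoint.smul ?_ (IsSelfAdjoint.one _)
    rw [isSelfAdjoint_iff, ← hS.ofReal_re_eq_of_mem_spectrum hz]
    simp
  have hRsa : IsSelfAdjoint ((u⁻¹ : (E →L[𝕜] E)ˣ) : E →L[𝕜] E) := by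
    have := husa.inv
    rwa [isSelfAdjoint_iff, Units.ext_iff, Units.coe_star] at this
  set r := ‖((u⁻¹ : (E →L[𝕜] E)ˣ) : E →L[𝕜] E)‖ with hr
  have hr0 : 0 < r := norm_pos_iff.2 (Units.ne_zero _)
  -- A spectral value `t` of the resolvent `u⁻¹` yields a point `w` of the spectrum of `T` with `z -
  -- w = t⁻¹`. Being selfadjoint, `u⁻¹` has such a value of modulus `r`.
  have key : ∀ t : 𝕜, ‖t‖ = r → t ∈ spectrum 𝕜 ((u⁻¹ : (E →L[𝕜] E)ˣ) : E →L[𝕜] E) →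
      ‖S - T‖ < r⁻¹ := by
    intro t ht hmem
    have ht0 : t ≠ 0 := by rw [← norm_pos_iff, ht]; exact hr0
    have h1 : t⁻¹ ∈ spectrum 𝕜 (u : E →L[𝕜] E) := by
      have := (spectrum.inv_mem_iff (r := Units.mk0 t ht0) (a := u⁻¹)).1 hmem
      simpa using this
    rw [hu, ← spectrum.singleton_sub_eq] at h1
    obtain ⟨_, rfl, w, hw, hw'⟩ := h1
    have := hfar w hw
    simp only at hw'
    rwa [hw', norm_inv, ht] at this
  have hlt : ‖S - T‖ < r⁻¹ := by
    rcases hRsa.norm_mem_spectrum_or_neg with h | h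
    · exact key _ (by simp [hr]) h
    · exact key _ (by simp [hr]) h
  -- Now `z - S` is closer than `1 / ‖u⁻¹‖` to the unit `z - T`, hence invertible.
  refine hz ((u.ofNearby (algebraMap 𝕜 (E →L[𝕜] E) z - S) ?_).isUnit)
  rwa [hu, sub_sub_sub_cancel_left, norm_sub_rev]

theorem IsSelfAdjoint.hausdorffDist_spectrum_le {𝕜 E : Type*} [RCLike 𝕜]
    [NormedAddCommGroup E] [InnerProductSpace 𝕜 E] [CompleteSpace E] [Nontrivial E]
    {S T : E →L[𝕜] E} (hS : IsSelfAdjoint S) (hT : IsSelfAdjoint T) :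
    Metric.hausdorffDist (spectrum 𝕜 S) (spectrum 𝕜 T) ≤ ‖S - T‖ := by
  refine Metric.hausdorffDist_le_of_mem_dist (norm_nonneg _) (fun z hz => ?_) fun z hz => ?_
  · simpa only [dist_eq_norm] using hS.exists_mem_spectrum_norm_sub_le hT hz
  · simpa only [dist_eq_norm, norm_sub_rev S T] using hT.exists_mem_spectrum_norm_sub_le hS hz

/-- Finiteness is needed for the triangle inequality, and it rules out the default value `0` of
`Metric.hausdorffDist` at infinite distance. -/
theorem IsSelfAdjoint.hausdorffEDist_spectrum_ne_top {𝕜 E E' : Type*} [RCLike 𝕜]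
    [NormedAddCommGroup E] [InnerProductSpace 𝕜 E] [CompleteSpace E] [Nontrivial E]
    [NormedAddCommGroup E'] [InnerProductSpace 𝕜 E'] [CompleteSpace E'] [Nontrivial E']
    {S : E →L[𝕜] E} {T : E' →L[𝕜] E'} (hS : IsSelfAdjoint S) (hT : IsSelfAdjoint T) :
    Metric.hausdorffEDist (spectrum 𝕜 S) (spectrum 𝕜 T) ≠ ⊤ :=
  Metric.hausdorffEDist_ne_top_of_nonempty_of_bounded hS.nonempty_spectrum hT.nonempty_spectrum
    (spectrum.isBounded S) (spectrum.isBounded T)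

/-! ### Square roots by a contraction argument -/

/-- If `y` is selfadjoint of norm less than one then `1 - y` has a selfadjoint square root. -/
theorem IsSelfAdjoint.exists_one_sub_sq_eq (𝕜 : Type*) {R : Type*} [RCLike 𝕜] [NormedRing R]
    [NormedAlgebra 𝕜 R]
    [CompleteSpace R] [StarRing R] [StarModule 𝕜 R] [ContinuousStar R] {y : R}
    (hy : IsSelfAdjoint y) (hlt : ‖y‖ < 1) :
    ∃ z : R, IsSelfAdjoint z ∧ (1 - z) * (1 - z) = 1 - y := by
  have hhalf : ‖(1 / 2 : 𝕜)‖ = 1 / 2 := by simp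
  have hhalf' : IsSelfAdjoint (1 / 2 : 𝕜) := by simp [isSelfAdjoint_iff]
  -- A fixed point satisfies `2z = y + z²`, that is `(1 - z)² = 1 - y`. On the ball of radius `‖y‖ <
  -- 1` the map `f` contracts by the factor `‖y‖`, and selfadjointness is a closed condition that
  -- `f` preserves.
  set f : R → R := fun z => (1 / 2 : 𝕜) • (y + z * z) with hf
  set s : Set R := {z | IsSelfAdjoint z} ∩ Metric.closedBall 0 ‖y‖ with hs
  have hclosed : IsClosed s :=
    (isClosed_eq continuous_star continuous_id).inter Metric.isClosed_closedBall
  have hmaps : Set.MapsTo f s s := by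
    rintro z ⟨hz, hz'⟩
    refine ⟨hhalf'.smul (hy.add (by simpa [sq] using hz.pow 2)), ?_⟩
    rw [mem_closedBall_zero_iff] at hz' ⊢
    rw [hf, norm_smul, hhalf]
    have h1 : ‖y + z * z‖ ≤ ‖y‖ + ‖z‖ * ‖z‖ := (norm_add_le _ _).trans (by grw [norm_mul_le])
    nlinarith [norm_nonneg z, norm_nonneg y]
  have hcontr : ContractingWith ‖y‖₊ (hmaps.restrict f s s) := by
    refine ⟨by exact_mod_cast hlt, LipschitzWith.of_dist_le_mul ?_⟩
    rintro ⟨a, ha, ha'⟩ ⟨b, hb, hb'⟩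
    rw [mem_closedBall_zero_iff] at ha' hb'
    rw [Subtype.dist_eq, Subtype.dist_eq, dist_eq_norm, dist_eq_norm]
    have h1 : f a - f b = (1 / 2 : 𝕜) • (a * (a - b) + (a - b) * b) := by
      rw [hf]
      simp only [← smul_sub]
      congr 1
      noncomm_ring
    change ‖f a - f b‖ ≤ ‖y‖ * ‖a - b‖
    rw [h1, norm_smul, hhalf]
    have h2 : ‖a * (a - b) + (a - b) * b‖ ≤ ‖a‖ * ‖a - b‖ + ‖a - b‖ * ‖b‖ :=
      (norm_add_le _ _).trans (add_le_add (norm_mul_le _ _) (norm_mul_le _ _))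
    nlinarith [norm_nonneg (a - b)]
  obtain ⟨z, hz, hfix, -⟩ := ContractingWith.exists_fixedPoint' hclosed.isComplete hmaps hcontr
    (x := 0) ⟨IsSelfAdjoint.zero _, by simp⟩ (edist_ne_top _ _)
  refine ⟨z, hz.1, ?_⟩
  have h3 : y + z * z = (2 : 𝕜) • z := by
    conv_rhs => rw [← hfix.eq]
    simp [hf, smul_smul]
  have h4 : (1 - z) * (1 - z) = 1 + z * z - (2 : 𝕜) • z := by
    rw [two_smul]
    noncomm_ring
  rw [h4, ← h3]
  abel

open RCLike in
/-- A selfadjoint operator bounded below by a positive constant has an invertible selfadjoint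
square root. -/
theorem IsSelfAdjoint.exists_isUnit_mul_self_eq {𝕜 E : Type*} [RCLike 𝕜]
    [NormedAddCommGroup E] [InnerProductSpace 𝕜 E] [CompleteSpace E] {B : E →L[𝕜] E}
    (hB : IsSelfAdjoint B) {ε : ℝ} (hε : 0 < ε)
    (h : ∀ x, ε * ‖x‖ ^ 2 ≤ re (inner 𝕜 (B x) x)) :
    ∃ K : E →L[𝕜] E, IsSelfAdjoint K ∧ IsUnit K ∧ K * K = B := by
  -- With this scale the form of `1 - B / c` lies between `0` and `1 - ε / c = ‖B‖ / c < 1`.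
  set c : ℝ := ‖B‖ + ε with hc
  have hc0 : 0 < c := by positivity
  have hsa : ∀ r : ℝ, IsSelfAdjoint ((r : ℝ) : 𝕜) := fun r => by simp [isSelfAdjoint_iff]
  set y : E →L[𝕜] E := 1 - ((c⁻¹ : ℝ) : 𝕜) • B with hy
  have hysa : IsSelfAdjoint y := (IsSelfAdjoint.one _).sub ((hsa _).smul hB)
  have hform : ∀ x, re (inner 𝕜 (y x) x) = ‖x‖ ^ 2 - c⁻¹ * re (inner 𝕜 (B x) x) := by
    intro x
    rw [hy, sub_apply, inner_sub_left, one_apply_eq_self, smul_apply,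
      inner_smul_left, conj_ofReal, map_sub, re_ofReal_mul, inner_self_eq_norm_sq]
  have hynorm : ‖y‖ ≤ ‖B‖ / c := by
    refine ContinuousLinearMap.norm_le_of_abs_re_inner_le hysa.isSymmetric (by positivity)
      fun x => ?_
    have h1 : re (inner 𝕜 (B x) x) ≤ ‖B‖ * ‖x‖ ^ 2 := by
      refine (re_le_norm _).trans ((norm_inner_le_norm _ _).trans ?_)
      rw [sq, ← mul_assoc]
      exact mul_le_mul_of_nonneg_right (B.le_opNorm x) (norm_nonneg _)
    have h2 := h x
    rw [hform, abs_le]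
    have h3 : ‖B‖ / c * ‖x‖ ^ 2 = ‖x‖ ^ 2 - c⁻¹ * (ε * ‖x‖ ^ 2) := by
      rw [hc]
      field_simp
      ring
    have h4 : c⁻¹ * (ε * ‖x‖ ^ 2) ≤ c⁻¹ * re (inner 𝕜 (B x) x) := by gcongr
    have h5 : c⁻¹ * re (inner 𝕜 (B x) x) ≤ c⁻¹ * (‖B‖ * ‖x‖ ^ 2) := by gcongr
    have h6 : c⁻¹ * (‖B‖ * ‖x‖ ^ 2) = ‖B‖ / c * ‖x‖ ^ 2 := by ring
    constructor <;> nlinarith [sq_nonneg ‖x‖]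
  have hy1 : ‖y‖ < 1 := hynorm.trans_lt (by rw [div_lt_one hc0]; linarith)
  obtain ⟨z, hz, hzy⟩ := hysa.exists_one_sub_sq_eq 𝕜 hy1
  have hKK : (((√c : ℝ) : 𝕜) • (1 - z)) * (((√c : ℝ) : 𝕜) • (1 - z)) = B := by
    rw [smul_mul_smul_comm, hzy, hy, sub_sub_cancel, smul_smul, ← ofReal_mul, ← ofReal_mul,
      Real.mul_self_sqrt hc0.le, mul_inv_cancel₀ hc0.ne']
    simp
  refine ⟨((√c : ℝ) : 𝕜) • (1 - z), (hsa _).smul ((IsSelfAdjoint.one _).sub hz), ?_, hKK⟩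
  rw [← isUnit_pow_iff two_ne_zero, sq, hKK]
  exact ContinuousLinearMap.isUnit_of_forall_mul_norm_sq_le hε
    fun x => (h x).trans (re_le_norm _)

/-! ### Multiplicative perturbation of the spectrum -/

/-- Conjugation by `X` carries `YX` to `XY`; bijectivity makes the spectra agree at `0` too. -/
theorem ContinuousLinearMap.spectrum_comp_comm_of_bijective {𝕜 E E' : Type*} [RCLike 𝕜]
    [NormedAddCommGroup E] [InnerProductSpace 𝕜 E] [CompleteSpace E]
    [NormedAddCommGroup E'] [InnerProductSpace 𝕜 E'] [CompleteSpace E']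
    (X : E →L[𝕜] E') (Y : E' →L[𝕜] E) (hX : Function.Bijective X) :
    spectrum 𝕜 (X ∘L Y) = spectrum 𝕜 (Y ∘L X) := by
  let e := ContinuousLinearEquiv.ofBijective X (LinearMap.ker_eq_bot.2 hX.1)
    (LinearMap.range_eq_top.2 hX.2)
  have h : e.conjContinuousAlgEquiv (Y ∘L X) = X ∘L Y := by
    ext y
    obtain ⟨x, rfl⟩ := hX.2 y
    rw [ContinuousLinearEquiv.conjContinuousAlgEquiv_apply_apply]
    change X (Y (X (e.symm (e x)))) = X (Y (X x))
    rw [e.symm_apply_apply]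
  rw [← h]
  exact AlgEquiv.spectrum_eq e.conjContinuousAlgEquiv.toAlgEquiv (Y ∘L X)

open RCLike in
/-- The multiplicative perturbation `T B T*` of a positive definite `B`. -/
theorem IsSelfAdjoint.hausdorffDist_spectrum_conj_le {𝕜 E E' : Type*} [RCLike 𝕜]
    [NormedAddCommGroup E] [InnerProductSpace 𝕜 E] [CompleteSpace E] [Nontrivial E]
    [NormedAddCommGroup E'] [InnerProductSpace 𝕜 E'] [CompleteSpace E']
    {B : E →L[𝕜] E} (hB : IsSelfAdjoint B) (T : E →L[𝕜] E') {ε b c : ℝ} (hε : 0 < ε)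
    (hb : 0 ≤ b) (hc : 0 ≤ c) (hc1 : c < 1)
    (hBε : ∀ x, ε * ‖x‖ ^ 2 ≤ re (inner 𝕜 (B x) x))
    (hBb : ∀ x, re (inner 𝕜 (B x) x) ≤ b * ‖x‖ ^ 2)
    (hT : ∀ x, (1 - c) * ‖x‖ ^ 2 ≤ ‖T x‖ ^ 2) (hT' : ∀ x, ‖T x‖ ^ 2 ≤ ‖x‖ ^ 2)
    (hTadj : ∀ y, (1 - c) * ‖y‖ ^ 2 ≤ ‖T.adjoint y‖ ^ 2) :
    Metric.hausdorffDist (spectrum 𝕜 B) (spectrum 𝕜 (T ∘L B ∘L T.adjoint)) ≤ b * c := by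
  obtain ⟨K, hK, hKu, hKK⟩ := hB.exists_isUnit_mul_self_eq hε hBε
  have hc' : 0 < 1 - c := by linarith
  have hKadj : K.adjoint = K := hK
  have hinj : Function.Injective T := by
    refine (injective_iff_map_eq_zero T).2 fun x hx => ?_
    have := hT x
    rw [hx, norm_zero] at this
    have : ‖x‖ ^ 2 ≤ 0 := by nlinarith
    simpa using this
  -- The bound on the adjoint makes `T T*` coercive, hence invertible.
  have hsurj : Function.Surjective T := by
    have hu : IsUnit (T ∘L T.adjoint) :=
      ContinuousLinearMap.isUnit_of_forall_mul_norm_sq_le hc' fun y => by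
        refine (hTadj y).trans (le_trans (le_of_eq ?_) (re_le_norm _))
        rw [ContinuousLinearMap.comp_apply, ← ContinuousLinearMap.adjoint_inner_right,
          inner_self_eq_norm_sq]
    have hbij := ContinuousLinearMap.isUnit_iff_bijective.1 hu
    exact Function.Surjective.of_comp (f := T) (g := T.adjoint) hbij.2
  have hX : Function.Bijective (T ∘L K) :=
    (show Function.Bijective T from ⟨hinj, hsurj⟩).comp
      (ContinuousLinearMap.isUnit_iff_bijective.1 hKu)
  have hcomp : T ∘L B ∘L T.adjoint = (T ∘L K) ∘L (T ∘L K).adjoint := by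
    rw [ContinuousLinearMap.adjoint_comp, hKadj, ← hKK]
    rfl
  -- Swapping the factors gives `K T*T K`, which acts on the same space as `B`, so the additive
  -- bound applies.
  rw [hcomp, ContinuousLinearMap.spectrum_comp_comm_of_bijective _ _ hX]
  have hsa : IsSelfAdjoint ((T ∘L K).adjoint ∘L (T ∘L K)) :=
    (ContinuousLinearMap.isPositive_adjoint_comp_self _).isSelfAdjoint
  refine (hB.hausdorffDist_spectrum_le hsa).trans ?_
  refine ContinuousLinearMap.norm_le_of_abs_re_inner_le (hB.sub hsa).isSymmetric (by positivity)
    fun x => ?_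
  have h1 : re (inner 𝕜 (B x) x) = ‖K x‖ ^ 2 := by
    rw [← hKK, mul_apply_eq_comp, ← inner_self_eq_norm_sq (𝕜 := 𝕜)]
    congr 1
    exact hK.isSymmetric (K x) x
  have h2 : re (inner 𝕜 ((B - (T ∘L K).adjoint ∘L (T ∘L K)) x) x)
      = ‖K x‖ ^ 2 - ‖T (K x)‖ ^ 2 := by
    rw [sub_apply, inner_sub_left, map_sub, h1, ContinuousLinearMap.comp_apply,
      ContinuousLinearMap.adjoint_inner_left, inner_self_eq_norm_sq]
    rfl
  rw [h2, abs_of_nonneg (sub_nonneg.2 (hT' _))]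
  have h3 := hBb x
  rw [h1] at h3
  nlinarith [hT (K x)]

/-! ### The gap and Ritz operators -/

theorem gap_comm {𝕜 H : Type*} [RCLike 𝕜] [NormedAddCommGroup H] [InnerProductSpace 𝕜 H]
    (F G : Submodule 𝕜 H) [F.HasOrthogonalProjection] [G.HasOrthogonalProjection] :
    gap F G = gap G F := norm_sub_rev _ _

theorem gap_nonneg {𝕜 H : Type*} [RCLike 𝕜] [NormedAddCommGroup H] [InnerProductSpace 𝕜 H]
    (F G : Submodule 𝕜 H) [F.HasOrthogonalProjection] [G.HasOrthogonalProjection] :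
    0 ≤ gap F G := norm_nonneg _

/-- On `G` the projector onto `Fᗮ` coincides with `P_G - P_F`. -/
theorem norm_orthogonal_starProjection_sq_le {𝕜 H : Type*} [RCLike 𝕜] [NormedAddCommGroup H]
    [InnerProductSpace 𝕜 H] (F G : Submodule 𝕜 H) [F.HasOrthogonalProjection]
    [G.HasOrthogonalProjection] {x : H} (hx : x ∈ G) :
    ‖Fᗮ.starProjection x‖ ^ 2 ≤ gap F G ^ 2 * ‖x‖ ^ 2 := by
  have h : Fᗮ.starProjection x = -((F.starProjection - G.starProjection) x) := by
    rw [sub_apply, Submodule.starProjection_eq_self_iff.2 hx, neg_sub, eq_sub_iff_add_eq, add_comm]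
    exact F.starProjection_add_starProjection_orthogonal x
  rw [h, norm_neg, ← mul_pow]
  exact pow_le_pow_left₀ (norm_nonneg _) (ContinuousLinearMap.le_opNorm _ x) 2

theorem norm_starProjection_sq_ge {𝕜 H : Type*} [RCLike 𝕜] [NormedAddCommGroup H]
    [InnerProductSpace 𝕜 H] (F G : Submodule 𝕜 H) [F.HasOrthogonalProjection]
    [G.HasOrthogonalProjection] {x : H} (hx : x ∈ G) :
    (1 - gap F G ^ 2) * ‖x‖ ^ 2 ≤ ‖F.starProjection x‖ ^ 2 := by
  have := F.norm_sq_eq_add_norm_sq_starProjection x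
  have := norm_orthogonal_starProjection_sq_le F G hx
  linarith

theorem inner_ritzOperator_apply {𝕜 H : Type*} [RCLike 𝕜] [NormedAddCommGroup H]
    [InnerProductSpace 𝕜 H] (A : H →L[𝕜] H) (G : Submodule 𝕜 H) [G.HasOrthogonalProjection]
    (x y : G) : inner 𝕜 (ritzOperator A G x) y = inner 𝕜 (A x) (y : H) :=
  Submodule.inner_orthogonalProjectionOnto_eq_of_mem_right y (A x)

theorem IsSelfAdjoint.ritzOperator {𝕜 H : Type*} [RCLike 𝕜] [NormedAddCommGroup H]
    [InnerProductSpace 𝕜 H] [CompleteSpace H] {A : H →L[𝕜] H} (hA : IsSelfAdjoint A)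
    (G : Submodule 𝕜 H) [CompleteSpace G] : IsSelfAdjoint (ritzOperator A G) := by
  rw [ContinuousLinearMap.isSelfAdjoint_iff_isSymmetric]
  intro x y
  calc
    inner 𝕜 (_root_.ritzOperator A G x) y = inner 𝕜 (A x) (y : H) := inner_ritzOperator_apply A G x y
    _ = inner 𝕜 (x : H) (A y) := hA.isSymmetric x y
    _ = star (inner 𝕜 (_root_.ritzOperator A G y) x) := by
        rw [inner_ritzOperator_apply]
        exact (inner_conj_symm _ _).symm
    _ = inner 𝕜 x (_root_.ritzOperator A G y) := inner_conj_symm _ _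

theorem restrict_eq_ritzOperator {𝕜 H : Type*} [RCLike 𝕜] [NormedAddCommGroup H]
    [InnerProductSpace 𝕜 H] {A : H →L[𝕜] H} {F : Submodule 𝕜 H} [F.HasOrthogonalProjection]
    (hF : ∀ x ∈ F, A x ∈ F) : A.restrict hF = ritzOperator A F := by
  ext x
  exact (Submodule.starProjection_eq_self_iff.2 (hF x x.2)).symm

theorem ritzOperator_add_algebraMap {𝕜 H : Type*} [RCLike 𝕜] [NormedAddCommGroup H]
    [InnerProductSpace 𝕜 H] (A : H →L[𝕜] H) (z : 𝕜) (G : Submodule 𝕜 H)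
    [G.HasOrthogonalProjection] :
    ritzOperator (A + algebraMap 𝕜 (H →L[𝕜] H) z) G =
      ritzOperator A G + algebraMap 𝕜 (G →L[𝕜] G) z := by
  refine ContinuousLinearMap.ext fun x => ext_inner_right 𝕜 fun y => ?_
  rw [inner_ritzOperator_apply, add_apply, add_apply, inner_add_left, inner_add_left,
    inner_ritzOperator_apply, ContinuousLinearMap.algebraMap_apply,
    ContinuousLinearMap.algebraMap_apply, inner_smul_left, inner_smul_left]
  rfl

/-! ### The bound for the Ritz values -/

-- The comparison passes through `T B T*` with `B = A|_F` and `T = P_G|_F`: the constant `b` pays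
-- for the conjugation by `T`, and `a` for the part of `A` on `Fᗮ`.
open RCLike in
theorem hausdorffDist_spectrum_ritzOperator_le_of_pos {𝕜 H : Type*} [RCLike 𝕜]
    [NormedAddCommGroup H] [InnerProductSpace 𝕜 H] [CompleteSpace H] {A : H →L[𝕜] H}
    (hA : IsSelfAdjoint A) (F G : Submodule 𝕜 H) [CompleteSpace F] [CompleteSpace G]
    (hF0 : F ≠ ⊥) (hG0 : G ≠ ⊥) (hF : ∀ x ∈ F, A x ∈ F) (hgap : gap F G < 1)
    {ε a b : ℝ} (hε : 0 < ε) (ha : 0 ≤ a) (hb : 0 ≤ b)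
    (hAε : ∀ x ∈ F, ε * ‖x‖ ^ 2 ≤ re (inner 𝕜 (A x) x))
    (hAb : ∀ x ∈ F, re (inner 𝕜 (A x) x) ≤ b * ‖x‖ ^ 2)
    (hAa : ∀ x ∈ Fᗮ, |re (inner 𝕜 (A x) x)| ≤ a * ‖x‖ ^ 2) :
    Metric.hausdorffDist (spectrum 𝕜 (ritzOperator A F)) (spectrum 𝕜 (ritzOperator A G)) ≤
      (a + b) * gap F G ^ 2 := by
  have := Submodule.nontrivial_iff_ne_bot.2 hF0
  have := Submodule.nontrivial_iff_ne_bot.2 hG0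
  set T : F →L[𝕜] G := G.orthogonalProjectionOnto ∘L F.subtypeL with hT
  have hTadj : T.adjoint = F.orthogonalProjectionOnto ∘L G.subtypeL := by
    rw [hT, ContinuousLinearMap.adjoint_comp, Submodule.adjoint_subtypeL,
      Submodule.adjoint_orthogonalProjectionOnto]
  have hB := hA.ritzOperator F
  have hTB : IsSelfAdjoint (T ∘L ritzOperator A F ∘L T.adjoint) := hB.conj_adjoint T
  have h1 : Metric.hausdorffDist (spectrum 𝕜 (ritzOperator A F))
      (spectrum 𝕜 (T ∘L ritzOperator A F ∘L T.adjoint)) ≤ b * gap F G ^ 2 := by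
    refine hB.hausdorffDist_spectrum_conj_le T hε hb (sq_nonneg _)
      (pow_lt_one₀ (gap_nonneg F G) hgap two_ne_zero) (fun x => ?_) (fun x => ?_) (fun x => ?_)
      (fun x => ?_) fun y => ?_
    · rw [inner_ritzOperator_apply]
      exact hAε x x.2
    · rw [inner_ritzOperator_apply]
      exact hAb x x.2
    · rw [gap_comm]
      exact norm_starProjection_sq_ge G F x.2
    · exact (le_add_of_nonneg_right (sq_nonneg _)).trans_eq
        (G.norm_sq_eq_add_norm_sq_projection (x : H)).symm
    · rw [hTadj]
      exact norm_starProjection_sq_ge F G y.2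
  have h2 : Metric.hausdorffDist (spectrum 𝕜 (T ∘L ritzOperator A F ∘L T.adjoint))
      (spectrum 𝕜 (ritzOperator A G)) ≤ a * gap F G ^ 2 := by
    rw [Metric.hausdorffDist_comm]
    refine ((hA.ritzOperator G).hausdorffDist_spectrum_le hTB).trans ?_
    refine ContinuousLinearMap.norm_le_of_abs_re_inner_le ((hA.ritzOperator G).sub hTB).isSymmetric
      (by positivity) fun y => ?_
    -- The cross terms between `F` and `Fᗮ` vanish by invariance, and `T B T*` accounts exactly for
    -- the `F` component.
    have h3 : inner 𝕜 ((ritzOperator A G - T ∘L ritzOperator A F ∘L T.adjoint) y) y =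
        inner 𝕜 (A (Fᗮ.starProjection (y : H))) (Fᗮ.starProjection (y : H)) := by
      set u : H := F.starProjection (y : H) with hu
      set v : H := Fᗮ.starProjection (y : H) with hv
      have huv : (y : H) = u + v := (F.starProjection_add_starProjection_orthogonal (y : H)).symm
      have huF : u ∈ F := Submodule.starProjection_apply_mem _ _
      have hvF : v ∈ Fᗮ := Submodule.starProjection_apply_mem _ _
      have h4 : inner 𝕜 ((T ∘L ritzOperator A F ∘L T.adjoint) y) y = inner 𝕜 (A u) u := by
        rw [ContinuousLinearMap.comp_apply, ← ContinuousLinearMap.adjoint_inner_right,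
          ContinuousLinearMap.comp_apply, inner_ritzOperator_apply, hTadj]
        rfl
      have h5 : inner 𝕜 (A u) v = 0 := (F.mem_orthogonal _).1 hvF _ (hF u huF)
      have h6 : inner 𝕜 (A v) u = 0 :=
        (F.mem_orthogonal' _).1 (orthogonal_invariant hA hF v hvF) _ huF
      rw [sub_apply, inner_sub_left, h4, inner_ritzOperator_apply, huv, map_add, inner_add_left,
        inner_add_right, inner_add_right, h5, h6]
      ring
    rw [h3]
    refine (hAa _ (Submodule.starProjection_apply_mem _ _)).trans ?_
    rw [mul_assoc]
    exact mul_le_mul_of_nonneg_left (norm_orthogonal_starProjection_sq_le F G y.2) ha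
  refine (Metric.hausdorffDist_triangle (hB.hausdorffEDist_spectrum_ne_top hTB)).trans ?_
  linarith

open RCLike in
/-- The estimate when the quadratic form of `A` is separated by `α` on `F` and `Fᗮ`. -/
theorem hausdorffDist_spectrum_ritzOperator_le_of_separated {𝕜 H : Type*} [RCLike 𝕜]
    [NormedAddCommGroup H] [InnerProductSpace 𝕜 H] [CompleteSpace H] {A : H →L[𝕜] H}
    (hA : IsSelfAdjoint A) (F G : Submodule 𝕜 H) [CompleteSpace F] [CompleteSpace G]
    (hF0 : F ≠ ⊥) (hG0 : G ≠ ⊥) (hF : ∀ x ∈ F, A x ∈ F) (hgap : gap F G < 1)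
    {m α M : ℝ} (hmα : m ≤ α) (hαM : α ≤ M)
    (hm : ∀ x, m * ‖x‖ ^ 2 ≤ re (inner 𝕜 (A x) x))
    (hM : ∀ x, re (inner 𝕜 (A x) x) ≤ M * ‖x‖ ^ 2)
    (hα : ∀ x ∈ F, α * ‖x‖ ^ 2 ≤ re (inner 𝕜 (A x) x))
    (hα' : ∀ x ∈ Fᗮ, re (inner 𝕜 (A x) x) ≤ α * ‖x‖ ^ 2) :
    Metric.hausdorffDist (spectrum 𝕜 (ritzOperator A F)) (spectrum 𝕜 (ritzOperator A G)) ≤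
      (M - m) * gap F G ^ 2 := by
  have key : ∀ ε : ℝ, 0 < ε → Metric.hausdorffDist (spectrum 𝕜 (ritzOperator A F))
      (spectrum 𝕜 (ritzOperator A G)) ≤ (M - m + 2 * ε) * gap F G ^ 2 := by
    intro ε hε
    -- After this shift the form is at least `ε` on `F` and lies between `m - α + ε` and `ε` on
    -- `Fᗮ`, whence `a = α - m + ε` and `b = M - α + ε` below.
    set z : 𝕜 := ((ε - α : ℝ) : 𝕜) with hz
    set A' : H →L[𝕜] H := A + algebraMap 𝕜 (H →L[𝕜] H) z with hA'
    have hform : ∀ x, re (inner 𝕜 (A' x) x) =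
        re (inner 𝕜 (A x) x) + (ε - α) * ‖x‖ ^ 2 := by
      intro x
      rw [hA', add_apply, inner_add_left, ContinuousLinearMap.inner_algebraMap_apply_self, map_add,
        mul_comm, re_ofReal_mul, hz, star_def, conj_ofReal, ofReal_re, mul_comm]
    have hA'sa : IsSelfAdjoint A' := by
      refine hA.add ?_
      rw [Algebra.algebraMap_eq_smul_one]
      exact IsSelfAdjoint.smul (by simp [isSelfAdjoint_iff, hz]) (IsSelfAdjoint.one _)
    have hA'F : ∀ x ∈ F, A' x ∈ F := fun x hx =>
      F.add_mem (hF x hx) (by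
        change algebraMap 𝕜 (H →L[𝕜] H) z x ∈ F
        rw [ContinuousLinearMap.algebraMap_apply]
        exact F.smul_mem _ hx)
    have h := hausdorffDist_spectrum_ritzOperator_le_of_pos hA'sa F G hF0 hG0 hA'F hgap
      (ε := ε) (a := α - m + ε) (b := M - α + ε) hε (by linarith) (by linarith)
      (fun x hx => by rw [hform]; linarith [hα x hx])
      (fun x hx => by rw [hform]; linarith [hM x])
      (fun x hx => by
        rw [hform, abs_le]
        constructor <;> nlinarith [hα' x hx, hm x, sq_nonneg ‖x‖])
    rw [hA', ritzOperator_add_algebraMap, ritzOperator_add_algebraMap, ← spectrum.add_singleton_eq,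
      ← spectrum.add_singleton_eq, Set.add_singleton, Set.add_singleton,
      Metric.hausdorffDist_image (isometry_add_right z)] at h
    linarith
  refine le_of_forall_pos_le_add fun δ hδ => ?_
  have h := key (δ / 2) (by positivity)
  have h1 : gap F G ^ 2 ≤ 1 := pow_le_one₀ (gap_nonneg F G) hgap.le
  nlinarith

theorem hausdorffDist_spectrum_neg {𝕜 R R' : Type*} [RCLike 𝕜] [Ring R] [Algebra 𝕜 R] [Ring R']
    [Algebra 𝕜 R'] (x : R) (y : R') :
    Metric.hausdorffDist (spectrum 𝕜 (-x)) (spectrum 𝕜 (-y)) =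
      Metric.hausdorffDist (spectrum 𝕜 x) (spectrum 𝕜 y) := by
  rw [← spectrum.neg_eq, ← spectrum.neg_eq, ← Set.image_neg_eq_neg, ← Set.image_neg_eq_neg,
    Metric.hausdorffDist_image isometry_neg]

theorem ritzOperator_neg {𝕜 H : Type*} [RCLike 𝕜] [NormedAddCommGroup H]
    [InnerProductSpace 𝕜 H] (A : H →L[𝕜] H) (G : Submodule 𝕜 H) [G.HasOrthogonalProjection] :
    ritzOperator (-A) G = -ritzOperator A G := by
  simp [ritzOperator]

-- All Ritz values are real and lie in `[m, M]`. This settles the case of gap at least one.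
open RCLike in
theorem hausdorffDist_spectrum_ritzOperator_le_of_le {𝕜 H : Type*} [RCLike 𝕜]
    [NormedAddCommGroup H] [InnerProductSpace 𝕜 H] [CompleteSpace H] {A : H →L[𝕜] H}
    (hA : IsSelfAdjoint A) (F G : Submodule 𝕜 H) [CompleteSpace F] [CompleteSpace G]
    (hF0 : F ≠ ⊥) (hG0 : G ≠ ⊥) {m M : ℝ}
    (hm : ∀ x, m * ‖x‖ ^ 2 ≤ re (inner 𝕜 (A x) x))
    (hM : ∀ x, re (inner 𝕜 (A x) x) ≤ M * ‖x‖ ^ 2) :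
    Metric.hausdorffDist (spectrum 𝕜 (ritzOperator A F)) (spectrum 𝕜 (ritzOperator A G)) ≤
      M - m := by
  have := Submodule.nontrivial_iff_ne_bot.2 hF0
  have := Submodule.nontrivial_iff_ne_bot.2 hG0
  have hbd : ∀ (U : Submodule 𝕜 H) [CompleteSpace U], ∀ z ∈ spectrum 𝕜 (ritzOperator A U),
      m ≤ re z ∧ re z ≤ M ∧ ((re z : ℝ) : 𝕜) = z := fun U _ z hz =>
    ⟨ContinuousLinearMap.le_re_of_mem_spectrum
        (fun x => by rw [inner_ritzOperator_apply]; exact hm x) hz,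
      ContinuousLinearMap.re_le_of_mem_spectrum
        (fun x => by rw [inner_ritzOperator_apply]; exact hM x) hz,
      (hA.ritzOperator U).ofReal_re_eq_of_mem_spectrum hz⟩
  have hdist : ∀ z ∈ spectrum 𝕜 (ritzOperator A F), ∀ w ∈ spectrum 𝕜 (ritzOperator A G),
      dist z w ≤ M - m := by
    intro z hz w hw
    obtain ⟨h1, h2, h3⟩ := hbd F z hz
    obtain ⟨h4, h5, h6⟩ := hbd G w hw
    rw [← h3, ← h6, dist_eq_norm, ← ofReal_sub, norm_ofReal, abs_le]
    constructor <;> linarith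
  obtain ⟨z, hz⟩ := (hA.ritzOperator F).nonempty_spectrum
  obtain ⟨w, hw⟩ := (hA.ritzOperator G).nonempty_spectrum
  exact Metric.hausdorffDist_le_of_mem_dist (dist_nonneg.trans (hdist z hz w hw))
    (fun z' hz' => ⟨w, hw, hdist z' hz' w hw⟩)
    fun w' hw' => ⟨z, hz, by rw [dist_comm]; exact hdist z hz w' hw'⟩

open RCLike in
/-- If the spectrum of the compression of `A` to `U` lies below that of the compression to `V`, then
the corresponding quadratic forms are separated by a number. -/
theorem exists_separating_of_forall_spectrum_le {𝕜 H : Type*} [RCLike 𝕜]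
    [NormedAddCommGroup H] [InnerProductSpace 𝕜 H] [CompleteSpace H] {A : H →L[𝕜] H}
    (hA : IsSelfAdjoint A) (U V : Submodule 𝕜 H) [CompleteSpace U] [CompleteSpace V]
    (hV0 : V ≠ ⊥)
    (h : ∀ μ ∈ spectrum 𝕜 (ritzOperator A U), ∀ l ∈ spectrum 𝕜 (ritzOperator A V), re μ ≤ re l) :
    ∃ α : ℝ, (α : 𝕜) ∈ spectrum 𝕜 (ritzOperator A V) ∧
      (∀ x ∈ V, α * ‖x‖ ^ 2 ≤ re (inner 𝕜 (A x) x)) ∧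
      ∀ x ∈ U, re (inner 𝕜 (A x) x) ≤ α * ‖x‖ ^ 2 := by
  have := Submodule.nontrivial_iff_ne_bot.2 hV0
  obtain ⟨α, hα, hform⟩ := (hA.ritzOperator V).exists_mem_spectrum_forall_le_re_inner
  refine ⟨α, hα, fun x hx => ?_, fun x hx => ?_⟩
  · have := hform ⟨x, hx⟩
    rwa [inner_ritzOperator_apply] at this
  -- On the zero space the spectrum is empty and gives no `β`, but the form bound is trivial.
  · rcases eq_or_ne U ⊥ with rfl | hU0
    · rw [(Submodule.mem_bot 𝕜).1 hx]
      simp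
    · have := Submodule.nontrivial_iff_ne_bot.2 hU0
      obtain ⟨β, hβ, hβform⟩ := (hA.ritzOperator U).exists_mem_spectrum_forall_re_inner_le
      have h1 := hβform ⟨x, hx⟩
      rw [inner_ritzOperator_apply] at h1
      have h2 := h _ hβ _ hα
      rw [ofReal_re, ofReal_re] at h2
      exact h1.trans (mul_le_mul_of_nonneg_right h2 (sq_nonneg _))

open RCLike in
theorem hausdorffDist_spectrum_ritzOperator_le_of_top {𝕜 H : Type*} [RCLike 𝕜]
    [NormedAddCommGroup H] [InnerProductSpace 𝕜 H] [CompleteSpace H] {A : H →L[𝕜] H}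
    (hA : IsSelfAdjoint A) (F G : Submodule 𝕜 H) [CompleteSpace F] [CompleteSpace G]
    (hF0 : F ≠ ⊥) (hG0 : G ≠ ⊥) (hF : ∀ x ∈ F, A x ∈ F)
    (htop : ∀ μ ∈ spectrum 𝕜 (ritzOperator A Fᗮ), ∀ l ∈ spectrum 𝕜 (ritzOperator A F),
      re μ ≤ re l) {m M : ℝ}
    (hm : ∀ x, m * ‖x‖ ^ 2 ≤ re (inner 𝕜 (A x) x))
    (hM : ∀ x, re (inner 𝕜 (A x) x) ≤ M * ‖x‖ ^ 2) :
    Metric.hausdorffDist (spectrum 𝕜 (ritzOperator A F)) (spectrum 𝕜 (ritzOperator A G)) ≤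
      (M - m) * gap F G ^ 2 := by
  obtain ⟨α, hα, h1, h2⟩ := exists_separating_of_forall_spectrum_le hA Fᗮ F hF0 htop
  have hmα : m ≤ α := by
    simpa using ContinuousLinearMap.le_re_of_mem_spectrum
      (fun x => by rw [inner_ritzOperator_apply]; exact hm x) hα
  have hαM : α ≤ M := by
    simpa using ContinuousLinearMap.re_le_of_mem_spectrum
      (fun x => by rw [inner_ritzOperator_apply]; exact hM x) hα
  rcases lt_or_ge (gap F G) 1 with hgap | hgap
  · exact hausdorffDist_spectrum_ritzOperator_le_of_separated hA F G hF0 hG0 hF hgap hmα hαM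
      hm hM h1 h2
  · refine (hausdorffDist_spectrum_ritzOperator_le_of_le hA F G hF0 hG0 hm hM).trans ?_
    exact le_mul_of_one_le_right (by linarith) (one_le_pow₀ hgap)

theorem mainTheorem3 {𝕜 H : Type*} [RCLike 𝕜] [NormedAddCommGroup H] [InnerProductSpace 𝕜 H]
    [CompleteSpace H] (A : H →L[𝕜] H) (hA : IsSelfAdjoint A)
    (F G : Submodule 𝕜 H) [CompleteSpace F] [CompleteSpace G] (hF0 : F ≠ ⊥) (hG0 : G ≠ ⊥)
    (hF : ∀ x ∈ F, A x ∈ F)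
    (hpart : IsTopSpectralPart hA hF ∨ IsBottomSpectralPart hA hF) :
    ∃ m M : ℝ,
      IsLeast (RCLike.re '' spectrum 𝕜 A) m ∧ IsGreatest (RCLike.re '' spectrum 𝕜 A) M ∧
      Metric.hausdorffEDist (spectrum 𝕜 (A.restrict hF)) (spectrum 𝕜 (ritzOperator A G)) ≠ ⊤ ∧
      Metric.hausdorffDist (spectrum 𝕜 (A.restrict hF)) (spectrum 𝕜 (ritzOperator A G)) ≤
        (M - m) * gap F G ^ 2 := by
  have := Submodule.nontrivial_iff_ne_bot.2 hF0
  have := Submodule.nontrivial_iff_ne_bot.2 hG0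
  have : Nontrivial H := (Submodule.subtype_injective F).nontrivial
  obtain ⟨m, hm, hmform⟩ := hA.exists_mem_spectrum_forall_le_re_inner
  obtain ⟨M, hM, hMform⟩ := hA.exists_mem_spectrum_forall_re_inner_le
  refine ⟨m, M, ⟨⟨m, hm, RCLike.ofReal_re m⟩, ?_⟩, ⟨⟨M, hM, RCLike.ofReal_re M⟩, ?_⟩, ?_, ?_⟩
  · rintro _ ⟨z, hz, rfl⟩
    exact ContinuousLinearMap.le_re_of_mem_spectrum hmform hz
  · rintro _ ⟨z, hz, rfl⟩
    exact ContinuousLinearMap.re_le_of_mem_spectrum hMform hz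
  · rw [restrict_eq_ritzOperator]
    exact (hA.ritzOperator F).hausdorffEDist_spectrum_ne_top (hA.ritzOperator G)
  · rw [IsTopSpectralPart, IsBottomSpectralPart, restrict_eq_ritzOperator hF,
      restrict_eq_ritzOperator (orthogonal_invariant hA hF)] at hpart
    rw [restrict_eq_ritzOperator hF]
    rcases hpart with htop | hbot
    · exact hausdorffDist_spectrum_ritzOperator_le_of_top hA F G hF0 hG0 hF htop hmform hMform
    -- Passing to `-A` turns the bottom part into the top part and preserves both the spread `M - m`
    -- and the Hausdorff distance.
    · have h := hausdorffDist_spectrum_ritzOperator_le_of_top hA.neg F G hF0 hG0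
        (fun x hx => F.neg_mem (hF x hx)) (m := -M) (M := -m) ?_ (fun x => ?_) fun x => ?_
      · rw [ritzOperator_neg, ritzOperator_neg, hausdorffDist_spectrum_neg] at h
        linarith
      · rw [ritzOperator_neg, ritzOperator_neg, ← spectrum.neg_eq, ← spectrum.neg_eq]
        intro μ hμ l hl
        have := hbot _ hμ _ hl
        rw [map_neg, map_neg] at this
        linarith
      · rw [neg_apply, inner_neg_left, map_neg]
        linarith [hMform x]
      · rw [neg_apply, inner_neg_left, map_neg]
        linarith [hmform x]
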